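/- **Definitions (ZFC).** For a cardinal $\kappa$ and a set $X$ let $P_\kappa(X)=\{A\subseteq X: |A|<\kappa\}$. An ultrafilter $U$ on $P_\kappa(X)$ is *fine* if $\{A\in P_\kappa(X): x\in A\}\in U$ for every $x\in X$; it is *$\kappa$-complete* if the intersection of fewer than $\kappa$ many sets in $U$ is in $U$; it is *normal* if every function $f$ that is defined on a set in $U$ and satisfies $f(A)\in A$ for all $A$ in its domain is constant on a set in $U$. An uncountable cardinal $\kappa$ is *strongly compact* if for every set $X$ there is a fine $\kappa$-complete ultrafilter on $P_\kappa(X)$, and *supercompact* if for every set $X$ there is a normal fine $\kappa$-complete ultrafilter on $P_\kappa(X)$. A *graph* is a pair $\langle G,E\rangle$ of a set $G$ and a binary relation $E$ on $G$; a *homomorphism* $\langle G,E\rangle\to\langle G',E'\rangle$ is a function $h:G\to G'$ such that $\langle v,w\rangle\in E$ implies $\langle h(v),h(w)\rangle\in E'$. *Semi-Weak Vopěnka's Principle* (SWVP) is the following statement of second-order set theory: there is no sequence (class function) $\langle G_\alpha:\alpha\in\mathrm{Ord}\rangle$ of graphs such that whenever $\alpha\le\alpha'$ there is a homomorphism $G_{\alpha'}\to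 G_\alpha$, and whenever $\alpha<\alpha'$ there is no homomorphism $G_\alpha\to G_{\alpha'}$. The structure $\langle V_{\kappa+1},\in\rangle$ is regarded as a structure for second-order set theory: all its elements are its classes, and those that belong to some element of it (the elements of $V_\kappa$) are its sets. GB + AC is Gödel–Bernays set theory with the Axiom of Choice for sets. **Theorem.** If $\kappa$ is both the least supercompact cardinal and the least strongly compact cardinal, then the structure $\langle V_{\kappa+1},\in\rangle$ satisfies SWVP and the statement "there is no strongly compact cardinal." Moreover, $\langle V_{\kappa+1},\in\rangle$ is a model of GB + AC. Hence, if there is such a cardinal $\kappa$, then over GB + AC the principle SWVP does not imply the existence of a strongly compact cardinal: not every structure that satisfies GB + AC and SWVP satisfies "there is a strongly compact cardinal." -/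

import Mathlib

open scoped Cardinal ZFSet

universe u v

/-! ## Strongly compact and supercompact cardinals

The sets of the ambient universe are the types in `Type u`; the corresponding cardinals are the
elements of `Cardinal.{u}`, and the corresponding cumulative hierarchy lives in `ZFSet.{u}`. -/

/-- The set of all subsets of `X` of cardinality less than `κ`. -/
abbrev SmallSubsets (κ : Cardinal.{u}) (X : Type u) : Type u := {A : Set X // #A < κ}

/-- Fineness: for every `x : X`, the set of all `A` with `x ∈ A` is in the ultrafilter. -/
def IsFineUltrafilter {κ : Cardinal.{u}} {X : Type u} (U : Ultrafilter (SmallSubsets κ X)) : Prop :=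
  ∀ x : X, {A : SmallSubsets κ X | x ∈ A.1} ∈ U

/-- Normality: every choice function defined on a set in the ultrafilter is constant on a set in
the ultrafilter. -/
def IsNormalUltrafilter {κ : Cardinal.{u}} {X : Type u}
    (U : Ultrafilter (SmallSubsets κ X)) : Prop :=
  ∀ S ∈ U, ∀ f : S → X, (∀ A : S, f A ∈ A.1.1) →
    ∃ x : X, {A : SmallSubsets κ X | ∃ h : A ∈ S, f ⟨A, h⟩ = x} ∈ U

/-- There is a fine `κ`-complete ultrafilter on the set of subsets of `X` of size less than `κ`. -/
def IsCompactFor (κ : Cardinal.{u}) (X : Type u) : Prop :=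
  ∃ U : Ultrafilter (SmallSubsets κ X),
    CardinalInterFilter (U : Filter (SmallSubsets κ X)) κ ∧ IsFineUltrafilter U

/-- There is a normal fine `κ`-complete ultrafilter on the set of subsets of `X` of size less than
`κ`. -/
def IsSupercompactFor (κ : Cardinal.{u}) (X : Type u) : Prop :=
  ∃ U : Ultrafilter (SmallSubsets κ X),
    CardinalInterFilter (U : Filter (SmallSubsets κ X)) κ ∧ IsFineUltrafilter U ∧
      IsNormalUltrafilter U

/-- `κ` is a strongly compact cardinal (of the ambient universe). -/
def IsStronglyCompact (κ : Cardinal.{u}) : Prop :=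
  ℵ₀ < κ ∧ ∀ X : Type u, IsCompactFor κ X

/-- `κ` is a supercompact cardinal (of the ambient universe). -/
def IsSupercompact (κ : Cardinal.{u}) : Prop :=
  ℵ₀ < κ ∧ ∀ X : Type u, IsSupercompactFor κ X

/-! ## The structure `⟨V_o, ∈⟩` -/

/-- The underlying set of the structure `⟨V_o, ∈⟩`: its elements are the elements of `V_o`. -/
@[ext]
structure VStructure (o : Ordinal.{u}) : Type (u + 1) where
  val : ZFSet.{u}
  property : val ∈ V_ o

/-- The membership relation of the structure `⟨V_o, ∈⟩` is the true membership relation. -/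
instance (o : Ordinal.{u}) : Membership (VStructure o) (VStructure o) :=
  ⟨fun y x => x.val ∈ y.val⟩

/-! ## Formulas of set theory, interpreted in a structure

Below, `M` is an arbitrary structure with one binary relation, written `∈`. Every definition is the
interpretation in `M` of a formula in the language of second-order set theory: all quantifiers
range over elements of `M`, and the only atomic formulas are `x ∈ y` and `x = y`. The elements of
`M` are the classes of the model, and the sets of the model are those classes that belong to some
class. -/

namespace SetModel

variable {M : Type v} [Membership M M]

/-- The class `x` is a set. -/
def IsSet (x : M) : Prop := ∃ y : M, x ∈ y

def Sub (x y : M) : Prop := ∀ z : M, z ∈ x → z ∈ y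

/-- `z = {a, b}`. -/
def IsUPair (z a b : M) : Prop := ∀ w : M, w ∈ z ↔ w = a ∨ w = b

/-- `p = ⟨a, b⟩`, the Kuratowski ordered pair `{{a}, {a, b}}`. -/
def IsOPair (p a b : M) : Prop :=
  ∃ s t : M, IsUPair s a a ∧ IsUPair t a b ∧ IsUPair p s t

/-- `⟨a, b⟩ ∈ f`. -/
def PairMem (a b f : M) : Prop := ∃ p : M, p ∈ f ∧ IsOPair p a b

/-- `f ⊆ a × b`. -/
def IsRel (f a b : M) : Prop :=
  ∀ p : M, p ∈ f → ∃ x y : M, x ∈ a ∧ y ∈ b ∧ IsOPair p x y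

/-- `f` is a function from `a` to `b`. -/
def IsFun (f a b : M) : Prop :=
  IsRel f a b ∧ ∀ x : M, x ∈ a → ∃! y : M, PairMem x y f

/-- `f` is a bijection from `a` to `b`. -/
def IsBij (f a b : M) : Prop :=
  IsFun f a b ∧ ∀ y : M, y ∈ b → ∃! x : M, PairMem x y f

/-- The sets `a` and `b` have the same cardinality. -/
def Equinumerous (a b : M) : Prop := ∃ f : M, IsSet f ∧ IsBij f a b

/-- `a` is an ordinal: a transitive set of transitive sets. -/
def IsOrd (a : M) : Prop :=
  IsSet a ∧ (∀ x : M, x ∈ a → Sub x a) ∧ ∀ x : M, x ∈ a → ∀ y : M, y ∈ x → Sub y x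

/-- `a` is a nonzero limit ordinal. -/
def IsLimitOrd (a : M) : Prop :=
  IsOrd a ∧ (∃ x : M, x ∈ a) ∧ ∀ x : M, x ∈ a → ∃ y : M, y ∈ a ∧ x ∈ y

/-- `w` is the least nonzero limit ordinal, `ω`. -/
def IsOmega (w : M) : Prop := IsLimitOrd w ∧ ∀ n : M, n ∈ w → ¬ IsLimitOrd n

/-- `k` is a cardinal: an ordinal not equinumerous with any smaller ordinal. -/
def IsCard (k : M) : Prop := IsOrd k ∧ ∀ a : M, a ∈ k → ¬ Equinumerous a k

/-- `k` is an uncountable cardinal, that is, a cardinal larger than `ω`. -/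
def IsUncountableCard (k : M) : Prop := IsCard k ∧ ∃ w : M, IsOmega w ∧ w ∈ k

/-- The set `x` has cardinality less than the cardinal `k`. -/
def CardLT (x k : M) : Prop := ∃ a : M, a ∈ k ∧ Equinumerous x a

/-- `P` is the set of all subsets of `X` of cardinality less than `k`. -/
def IsSmallSubsets (P k X : M) : Prop :=
  IsSet P ∧ ∀ a : M, a ∈ P ↔ IsSet a ∧ Sub a X ∧ CardLT a k

/-- `U` is an ultrafilter on the set `P` that is `k`-complete: the intersection of fewer than `k`
many sets in `U` is in `U`. Here `k` is always an uncountable cardinal, so this includes closure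
under intersections of two sets. -/
structure IsCompleteUltrafilter (U P k : M) : Prop where
  isSet : IsSet U
  sub : ∀ S : M, S ∈ U → Sub S P
  whole : P ∈ U
  proper : ∀ S : M, S ∈ U → ∃ a : M, a ∈ S
  upward : ∀ S T : M, S ∈ U → Sub S T → Sub T P → T ∈ U
  ultra : ∀ S : M, IsSet S → Sub S P →
    S ∈ U ∨ ∃ T : M, T ∈ U ∧ ∀ a : M, a ∈ T ↔ a ∈ P ∧ ¬ a ∈ S
  complete : ∀ A : M, IsSet A → Sub A U → CardLT A k →
    ∃ T : M, T ∈ U ∧ ∀ a : M, a ∈ T ↔ a ∈ P ∧ ∀ S : M, S ∈ A → a ∈ S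

/-- `U`, an ultrafilter on the set `P` of subsets of `X` of cardinality less than some cardinal, is
fine: for every `x ∈ X`, the set `{a ∈ P : x ∈ a}` is in `U`. -/
def IsFine (U P X : M) : Prop :=
  ∀ x : M, x ∈ X → ∃ T : M, T ∈ U ∧ ∀ a : M, a ∈ T ↔ a ∈ P ∧ x ∈ a

/-- `k` is a strongly compact cardinal in the sense of `M`. -/
def IsStronglyCompactIn (k : M) : Prop :=
  IsUncountableCard k ∧ ∀ X : M, IsSet X →
    ∃ P U : M, IsSmallSubsets P k X ∧ IsCompleteUltrafilter U P k ∧ IsFine U P X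

/-- `g` is the graph `⟨v, e⟩`, where `v` is a set and `e` is a binary relation on `v`. -/
def IsGraphWith (g v e : M) : Prop := IsOPair g v e ∧ IsRel e v v

/-- `g` is a graph. -/
def IsGraph (g : M) : Prop := ∃ v e : M, IsGraphWith g v e

/-- `h` is a homomorphism from the graph `g` to the graph `g'`. -/
def IsGraphHom (h g g' : M) : Prop :=
  ∃ v e v' e' : M, IsGraphWith g v e ∧ IsGraphWith g' v' e' ∧ IsFun h v v' ∧
    ∀ x y x' y' : M, PairMem x y e → PairMem x x' h → PairMem y y' h → PairMem x' y' e'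

/-- There is a homomorphism from the graph `g` to the graph `g'`. -/
def HomExists (g g' : M) : Prop := ∃ h : M, IsSet h ∧ IsGraphHom h g g'

/-- The class `F` is a sequence `⟨G_α : α ∈ Ord⟩` of graphs: a class function that has the class of
all ordinals as its domain and all of whose values are graphs. -/
def IsGraphSequence (F : M) : Prop :=
  (∀ p : M, p ∈ F → ∃ α g : M, IsOrd α ∧ IsGraph g ∧ IsOPair p α g) ∧
    ∀ α : M, IsOrd α → ∃! g : M, PairMem α g F

variable (M)

/-- `M` satisfies "there is a strongly compact cardinal". -/
def SatisfiesExistsStronglyCompact : Prop := ∃ k : M, IsStronglyCompactIn k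

/-- `M` satisfies Semi-Weak Vopěnka's Principle: there is no sequence `⟨G_α : α ∈ Ord⟩` of graphs
such that there is a homomorphism from `G_β` to `G_α` whenever `α ≤ β`, and there is no
homomorphism from `G_α` to `G_β` whenever `α < β`. -/
def SatisfiesSWVP : Prop :=
  ¬ ∃ F : M, IsGraphSequence F ∧
    (∀ α β g g' : M, IsOrd α → IsOrd β → PairMem α g F → PairMem β g' F →
      (α ∈ β ∨ α = β) → HomExists g' g) ∧
    (∀ α β g g' : M, IsOrd α → IsOrd β → PairMem α g F → PairMem β g' F →
      α ∈ β → ¬ HomExists g g')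

end SetModel

/-! ## Gödel–Bernays set theory with the Axiom of Choice for sets -/

/-- First-order formulas in the language `∈, =`, with variables indexed by natural numbers and with
quantification over sets only; their free variables may stand for classes. -/
inductive ClassFormula : Type
  | mem (i j : ℕ) : ClassFormula
  | eq (i j : ℕ) : ClassFormula
  | neg (φ : ClassFormula) : ClassFormula
  | and (φ ψ : ClassFormula) : ClassFormula
  | allSets (i : ℕ) (φ : ClassFormula) : ClassFormula

/-- Truth of a formula in `M` under an assignment of elements of `M` to the variables. -/
def ClassFormula.Holds {M : Type v} [Membership M M] : ClassFormula → (ℕ → M) → Prop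
  | .mem i j, a => a i ∈ a j
  | .eq i j, a => a i = a j
  | .neg φ, a => ¬ φ.Holds a
  | .and φ ψ, a => φ.Holds a ∧ ψ.Holds a
  | .allSets i φ, a => ∀ x : M, SetModel.IsSet x → φ.Holds (Function.update a i x)

namespace SetModel

/-- `M` satisfies the axioms of Gödel–Bernays set theory with the Axiom of Choice for sets. -/
structure SatisfiesGBAC (M : Type v) [Membership M M] : Prop where
  extensionality : ∀ X Y : M, (∀ z : M, z ∈ X ↔ z ∈ Y) → X = Y
  /-- The sets satisfying a given formula, with class parameters, form a class. -/
  comprehension : ∀ (φ : ClassFormula) (a : ℕ → M),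
    ∃ C : M, ∀ x : M, x ∈ C ↔ IsSet x ∧ φ.Holds (Function.update a 0 x)
  /-- Every nonempty class has an element that is disjoint from it. -/
  foundation : ∀ X : M, (∃ x : M, x ∈ X) → ∃ x : M, x ∈ X ∧ ∀ z : M, z ∈ x → ¬ z ∈ X
  pairing : ∀ a b : M, IsSet a → IsSet b → ∃ z : M, IsSet z ∧ IsUPair z a b
  union : ∀ a : M, IsSet a → ∃ z : M, IsSet z ∧ ∀ x : M, x ∈ z ↔ ∃ y : M, y ∈ a ∧ x ∈ y
  powerset : ∀ a : M, IsSet a → ∃ z : M, IsSet z ∧ ∀ x : M, x ∈ z ↔ IsSet x ∧ Sub x a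
  infinity : ∃ w : M, IsSet w ∧ (∃ e : M, e ∈ w ∧ ∀ z : M, ¬ z ∈ e) ∧
    ∀ x : M, x ∈ w → ∃ y : M, y ∈ w ∧ ∀ z : M, z ∈ y ↔ z ∈ x ∨ z = x
  /-- The image of a set under a (possibly partial) class function is a set. -/
  replacement : ∀ F a : M, IsSet a →
    (∀ x y y' : M, PairMem x y F → PairMem x y' F → y = y') →
    ∃ b : M, IsSet b ∧ ∀ y : M, y ∈ b ↔ ∃ x : M, x ∈ a ∧ PairMem x y F
  /-- Every set of nonempty sets has a choice function. -/
  choice : ∀ a : M, IsSet a → (∀ x : M, x ∈ a → ∃ y : M, y ∈ x) →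
    ∃ f : M, IsSet f ∧ (∀ p : M, p ∈ f → ∃ x y : M, x ∈ a ∧ y ∈ x ∧ IsOPair p x y) ∧
      ∀ x : M, x ∈ a → ∃! y : M, PairMem x y f

end SetModel

/-! ### Ultrafilters on `SmallSubsets κ X`: completeness, fineness and normality -/

section Ultrafilters

open Filter

variable {κ μ : Cardinal.{u}} {X : Type u}

/-! A strongly compact `κ` is inaccessible, so `V_{κ+1}` is a model of GB + AC whose sets are the
elements of `V_κ` and whose classes are all subsets of `V_κ`. Inaccessibility also makes every graph
in the model smaller than `κ`.

SWVP holds by supercompactness (`IsSupercompact.exists_hom`). A class sequence of graphs is a true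
`κ`-sequence. Take a normal fine ultrafilter on the small subsets of `κ` together with the product
of the vertex sets. A typical `A` meets `κ` in an ordinal `δ` and behaves like an elementary
submodel. The images of a vertex of `G_δ` under the given maps to the earlier graphs form a thread
below `δ`, which extends to a member of the product lying in `A`. Evaluating the extended threads at
some `ε > δ` is a homomorphism from `G_δ` to `G_ε`: a failure at `ε` would reflect to an index below
`δ`, where the given maps preserve edges.

There is no strongly compact cardinal in the model: such a cardinal would be some `μ < κ` that is
truly compact for all sets of size less than `κ`. Integrating these ultrafilters along one
witnessing the strong compactness of `κ` (`IsStronglyCompact.isCompactFor`) makes `μ` strongly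
compact, against the minimality of `κ`. -/

theorem IsFineUltrafilter.eventually_subset {U : Ultrafilter (SmallSubsets κ X)}
    [CardinalInterFilter (U : Filter (SmallSubsets κ X)) κ] (hU : IsFineUltrafilter U)
    {B : Set X} (hB : #B < κ) : ∀ᶠ A in (U : Filter (SmallSubsets κ X)), B ⊆ A.1 :=
  (eventually_cardinal_ball (p := fun (A : SmallSubsets κ X) x _ => x ∈ A.1) hB).2
    fun x _ => hU x

theorem IsNormalUltrafilter.exists_eventually {U : Ultrafilter (SmallSubsets κ X)}
    (hU : IsNormalUltrafilter U) {p : SmallSubsets κ X → X → Prop}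
    (h : ∀ᶠ A in (U : Filter (SmallSubsets κ X)), ∃ x ∈ A.1, p A x) :
    ∃ x, ∀ᶠ A in (U : Filter (SmallSubsets κ X)), p A x := by
  obtain ⟨x, hx⟩ := hU {A | ∃ x ∈ A.1, p A x} h (fun A => A.2.choose)
    (fun A => A.2.choose_spec.1)
  refine ⟨x, mem_of_superset hx ?_⟩
  rintro A ⟨hA, rfl⟩
  exact hA.choose_spec.2

/-- Closure under diagonal intersections: if it failed, choosing a bad `x ∈ A` would be regressive,
hence constant on a large set by normality. -/
theorem IsNormalUltrafilter.eventually_forall_mem {U : Ultrafilter (SmallSubsets κ X)}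
    (hU : IsNormalUltrafilter U) {p : SmallSubsets κ X → X → Prop}
    (h : ∀ x, ∀ᶠ A in (U : Filter (SmallSubsets κ X)), p A x) :
    ∀ᶠ A in (U : Filter (SmallSubsets κ X)), ∀ x ∈ A.1, p A x := by
  by_contra hc
  rw [← Ultrafilter.eventually_not] at hc
  obtain ⟨x, hx⟩ := hU.exists_eventually (p := fun A x => ¬ p A x)
    (hc.mono fun A hA => by simpa using hA)
  obtain ⟨A, h1, h2⟩ := (hx.and (h x)).exists
  exact h1 h2

theorem Ultrafilter.exists_eventually_eq {α β : Type u} (D : Ultrafilter α)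
    [CardinalInterFilter (D : Filter α) κ] (hβ : #β < κ) (f : α → β) :
    ∃ b, ∀ᶠ a in (D : Filter α), f a = b := by
  by_contra! hc
  have h : ∀ b, ∀ᶠ a in (D : Filter α), f a ≠ b := hc
  obtain ⟨a, ha⟩ := ((eventually_cardinal_forall hβ).2 h).exists
  exact ha _ rfl

/-! ### Inaccessibility of strongly compact cardinals, and supercompact reflection -/

/-- Given a cofinal set of size less than `κ`, some `A` would include all the initial segments it
determines, hence all of `κ`, although `A` has size less than `κ`. -/
theorem IsCompactFor.le_cof_ord (h : IsCompactFor κ κ.ord.ToType) (hκ : ℵ₀ < κ) :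
    κ ≤ κ.ord.cof := by
  obtain ⟨U, hc, hf⟩ := h
  by_contra! hlt
  obtain ⟨S, hS, hS'⟩ := Order.exists_cof_eq (α := κ.ord.ToType)
  rw [Ordinal.cof_toType] at hS'
  have h1 : ∀ s : κ.ord.ToType, ∀ᶠ A in (U : Filter (SmallSubsets κ _)), Set.Iic s ⊆ A.1 :=
    fun s => hf.eventually_subset (by simpa using Cardinal.mk_Iic_lt s (by simp) (by simpa using hκ.le))
  obtain ⟨A, hA⟩ := ((eventually_cardinal_ball (hS' ▸ hlt)
    (p := fun (A : SmallSubsets κ _) s _ => Set.Iic s ⊆ A.1)).2 fun s _ => h1 s).exists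
  have : A.1 = Set.univ := Set.eq_univ_of_forall fun x => by
    obtain ⟨s, hs, hxs⟩ := hS x
    exact hA s hs hxs
  have h2 := A.2
  rw [this] at h2
  simp at h2

/-- If `κ` injects into the power set of a set `I` of size less than `κ`, choose `g A ∉ A`. Each of
the fewer than `κ` bits of the code of `g A` is almost everywhere constant, so `g` is too; by
fineness its constant value lies in almost every `A`. -/
theorem IsCompactFor.isStrongPrelimit (h : IsCompactFor κ κ.ord.ToType) :
    κ.IsStrongPrelimit := by
  obtain ⟨U, hc, hf⟩ := h
  intro μ hμ
  by_contra! hle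
  induction μ using Cardinal.inductionOn with | mk I
  have : #κ.ord.ToType ≤ #(Set I) := by simpa using hle
  obtain ⟨e⟩ := this
  have hne : ∀ A : SmallSubsets κ κ.ord.ToType, ∃ x, x ∉ A.1 := fun A => by
    by_contra! hA
    have h2 := A.2
    rw [Set.eq_univ_of_forall hA] at h2
    simp at h2
  choose g hg using hne
  have h1 : ∀ i : I, ∃ b : Prop, ∀ᶠ A in (U : Filter (SmallSubsets κ _)), (i ∈ e (g A)) = b := by
    intro i
    by_cases hi : ∀ᶠ A in (U : Filter (SmallSubsets κ _)), i ∈ e (g A)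
    · exact ⟨True, hi.mono fun A hA => by simpa using hA⟩
    · exact ⟨False, (Ultrafilter.eventually_not.2 hi).mono fun A hA => by simpa using hA⟩
  choose b hb using h1
  have h2 := (eventually_cardinal_forall hμ).2 hb
  obtain ⟨A, hA⟩ := h2.exists
  obtain ⟨B, hB, hgB⟩ := (h2.and (hf (g A))).exists
  refine hg B ?_
  have : g B = g A := e.injective <| Set.ext fun i => by
    rw [hB i, hA i]
  rwa [this]

theorem IsStronglyCompact.isInaccessible (h : IsStronglyCompact κ) : κ.IsInaccessible :=
  ⟨h.1, (h.2 _).le_cof_ord h.1, (h.2 _).isStrongPrelimit⟩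

/-- Strong compactness of `κ` extends local strong compactness of `μ` below `κ` to all sets. -/
theorem IsStronglyCompact.isCompactFor (hκ : IsStronglyCompact κ) (hμκ : μ ≤ κ)
    (hμ : ∀ A : Type u, #A < κ → IsCompactFor μ A) (X : Type u) : IsCompactFor μ X := by
  obtain ⟨U, hc, hf⟩ := hκ.2 X
  choose V hVc hVf using fun A : SmallSubsets κ X => hμ A.1 A.2
  let m (A : SmallSubsets κ X) (B : SmallSubsets μ A.1) : SmallSubsets μ X :=
    ⟨Subtype.val '' B.1, Cardinal.mk_image_le.trans_lt B.2⟩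
  -- A set is large when, for `U`-almost every `A`, it contains `V A`-almost every small subset of
  -- `A`. Since `μ ≤ κ`, intersections of fewer than `μ` sets pass through both quantifiers.
  refine ⟨U.bind fun A => (V A).map (m A), ⟨?_⟩, ?_⟩
  · intro S hS hmem
    change ∀ᶠ A in (U : Filter (SmallSubsets κ X)), ∀ᶠ B in (V A : Filter (SmallSubsets μ A.1)),
      m A B ∈ ⋂₀ S
    have h1 : ∀ᶠ A in (U : Filter (SmallSubsets κ X)), ∀ s ∈ S,
        ∀ᶠ B in (V A : Filter (SmallSubsets μ A.1)), m A B ∈ s :=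
      (eventually_cardinal_ball (hS.trans_le hμκ)
        (p := fun A s _ => ∀ᶠ B in (V A : Filter (SmallSubsets μ A.1)), m A B ∈ s)).2 hmem
    exact h1.mono fun A hA => (eventually_cardinal_ball hS
      (p := fun B s _ => m A B ∈ s)).2 hA
  · intro x
    change ∀ᶠ A in (U : Filter (SmallSubsets κ X)), ∀ᶠ B in (V A : Filter (SmallSubsets μ A.1)),
      x ∈ (m A B).1
    exact mem_of_superset (hf x) fun A (hA : x ∈ A.1) => mem_of_superset (hVf A ⟨x, hA⟩)
      fun B hB => ⟨⟨x, hA⟩, hB, rfl⟩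

/-- A supercompact cardinal reflects homomorphisms between graphs: a sequence of graphs of length
`κ` with homomorphisms from later graphs to earlier ones has a homomorphism from an earlier graph
to a later one. -/
theorem IsSupercompact.exists_hom (hκ : IsSupercompact κ) {V : κ.ord.ToType → Type u}
    (hV : ∀ i, #(V i) < κ) (E : ∀ i, V i → V i → Prop)
    (h : ∀ i j, i < j → ∃ φ : V j → V i, ∀ x y, E j x y → E i (φ x) (φ y)) :
    ∃ i j, i < j ∧ ∃ φ : V i → V j, ∀ x y, E i x y → E j (φ x) (φ y) := by
  have hlim : ∀ i : κ.ord.ToType, ∃ j, i < j := by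
    have := Cardinal.noMaxOrder hκ.1.le
    exact exists_gt
  -- The empty graph maps into everything. Otherwise all `V i` are inhabited, so the homomorphisms
  -- can be chosen as total functions of `i` and `j`.
  by_cases hempty : ∃ i, IsEmpty (V i)
  · obtain ⟨i, hi⟩ := hempty
    obtain ⟨j, hj⟩ := hlim i
    exact ⟨i, j, hj, isEmptyElim, fun x => isEmptyElim x⟩
  have hne : ∀ i, Nonempty (V i) := by simpa using hempty
  choose! φ hφ using h
  obtain ⟨U, hc, hf, hn⟩ := hκ.2 (κ.ord.ToType ⊕ ∀ i, V i)
  have hIio : ∀ i : κ.ord.ToType, #(Set.Iio i) < κ := fun i => by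
    simpa using Cardinal.mk_Iio_lt i
  -- the part of `A` in `κ` is an initial segment
  have h1 : ∀ᶠ A in U.toFilter, ∀ i : κ.ord.ToType, Sum.inl i ∈ A.1 →
      ∀ j < i, Sum.inl j ∈ A.1 := by
    have := hn.eventually_forall_mem (p := fun A x => ∀ i, x = Sum.inl i → ∀ j < i, Sum.inl j ∈ A.1)
      (by
        rintro (i | c)
        · filter_upwards [(eventually_cardinal_ball (hIio i)
            (p := fun (A : SmallSubsets κ (κ.ord.ToType ⊕ ∀ i, V i)) j _ => Sum.inl j ∈ A.1)).2
            fun j _ => hf _]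
          rintro A hA _ ⟨⟩
          exact hA
        · simp)
    exact this.mono fun A hA i hi => hA _ hi i rfl
  -- `A` is too small to contain all of `κ`; `δ` is the least index it omits.
  have h2 : ∀ᶠ A in U.toFilter, ∃ δ : κ.ord.ToType,
      ∀ i, Sum.inl i ∈ A.1 ↔ i < δ := by
    filter_upwards [h1] with A hA
    have hne : {i : κ.ord.ToType | Sum.inl i ∉ A.1}.Nonempty := by
      by_contra! hempty
      have : Function.Injective fun i : κ.ord.ToType =>
          (⟨Sum.inl i, by
            by_contra hi
            exact (hempty ▸ hi : i ∈ (∅ : Set κ.ord.ToType))⟩ : A.1) := fun i j hij => by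
        simpa using hij
      have := (Cardinal.mk_le_of_injective this).trans_lt A.2
      simp at this
    refine ⟨wellFounded_lt.min _ hne, fun i => ⟨fun hi => ?_, fun hi => ?_⟩⟩
    · by_contra! hle
      rcases hle.eq_or_lt with rfl | hlt
      · exact wellFounded_lt.min_mem _ hne hi
      · exact wellFounded_lt.min_mem _ hne (hA i hi _ hlt)
    · by_contra hi'
      exact wellFounded_lt.not_lt_min _ hi' hi
  -- Elementarity of `A`, in the only form needed: if two threads in `A` fail to be adjacent at some
  -- index, they fail at an index in `A`. For fixed threads this is fineness at one witness; two
  -- diagonal intersections give all pairs.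
  have h3 : ∀ᶠ A in U.toFilter, ∀ c d : ∀ i, V i, Sum.inr c ∈ A.1 →
      Sum.inr d ∈ A.1 → (∃ i, ¬ E i (c i) (d i)) → ∃ i, Sum.inl i ∈ A.1 ∧ ¬ E i (c i) (d i) := by
    have := hn.eventually_forall_mem (p := fun A x => ∀ y ∈ A.1, ∀ c d, x = Sum.inr c →
      y = Sum.inr d → (∃ i, ¬ E i (c i) (d i)) → ∃ i, Sum.inl i ∈ A.1 ∧ ¬ E i (c i) (d i))
      (fun x => hn.eventually_forall_mem (fun y => by
        by_cases hxy : ∃ c d i, x = Sum.inr c ∧ y = Sum.inr d ∧ ¬ E i (c i) (d i)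
        · obtain ⟨c, d, i, rfl, rfl, hi⟩ := hxy
          filter_upwards [hf (Sum.inl i)]
          rintro A hA _ _ ⟨⟩ ⟨⟩ -
          exact ⟨i, hA, hi⟩
        · exact Eventually.of_forall fun A c d hx hy ⟨i, hi⟩ =>
            (hxy ⟨c, d, i, hx, hy, hi⟩).elim))
    exact this.mono fun A hA c d hc hd => hA _ hc _ hd _ _ rfl rfl
  -- Every vertex of `V δ` has its thread of images below `δ` extended by a member of `A`. Otherwise
  -- choose a counterexample `d A` for almost every `A`. Since `V i` is small, its image there is
  -- almost everywhere a constant `c i`. By normality `c` agrees with the thread at all indices in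
  -- `A`, and by fineness `c` lies in `A`.
  have h4 : ∀ᶠ A in U.toFilter, ∀ δ : κ.ord.ToType,
      (∀ i, Sum.inl i ∈ A.1 ↔ i < δ) → ∀ g : V δ, ∃ c : ∀ i, V i, Sum.inr c ∈ A.1 ∧
        ∀ i < δ, c i = φ i δ g := by
    by_contra hcon
    rw [← Ultrafilter.eventually_not] at hcon
    have hcon' : ∀ᶠ A in U.toFilter,
        ∃ d : (Σ δ, V δ), (∀ i, Sum.inl i ∈ A.1 ↔ i < d.1) ∧
        ∀ c : ∀ i, V i, Sum.inr c ∈ A.1 → ∃ i < d.1, c i ≠ φ i d.1 d.2 := by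
      filter_upwards [hcon] with A hA
      push Not at hA
      obtain ⟨δ, hδ, g, hg⟩ := hA
      exact ⟨⟨δ, g⟩, hδ, hg⟩
    obtain ⟨A₀, d₀, -⟩ := hcon'.exists
    have : Nonempty (Σ δ, V δ) := ⟨d₀⟩
    choose! d hd using fun A : SmallSubsets κ (κ.ord.ToType ⊕ ∀ i, V i) =>
      (id : (∃ d : (Σ δ, V δ), (∀ i, Sum.inl i ∈ A.1 ↔ i < d.1) ∧
        ∀ c : ∀ i, V i, Sum.inr c ∈ A.1 → ∃ i < d.1, c i ≠ φ i d.1 d.2) → _)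
    have hd' := hcon'.mono hd
    have hex : ∀ i, ∃ v : V i, ∀ᶠ A in U.toFilter,
        φ i (d A).1 (d A).2 = v := fun i =>
      U.exists_eventually_eq (hV i) _
    choose c hc using hex
    have h5 : ∀ᶠ A in U.toFilter, ∀ i, Sum.inl i ∈ A.1 →
        φ i (d A).1 (d A).2 = c i := by
      have := hn.eventually_forall_mem (p := fun A x => ∀ i, x = Sum.inl i →
        φ i (d A).1 (d A).2 = c i) (by
          rintro (i | e)
          · filter_upwards [hc i]
            rintro A hA _ ⟨⟩
            exact hA
          · simp)
      exact this.mono fun A hA i hi => hA _ hi i rfl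
    obtain ⟨A, hA5, hAd, hAc⟩ := (h5.and (hd'.and (hf (Sum.inr c)))).exists
    obtain ⟨i, hi, hne⟩ := hAd.2 c hAc
    exact hne (hA5 i ((hAd.1 i).2 hi)).symm
  obtain ⟨A, ⟨δ, hδ⟩, hA3, hA4⟩ := (h2.and (h3.and h4)).exists
  obtain ⟨ε, hε⟩ := hlim δ
  choose ψ hψ hψ' using hA4 δ hδ
  -- The homomorphism reads off at `ε` the extended thread of each vertex of `V δ`.
  refine ⟨δ, ε, hε, fun g => ψ g ε, fun x y hxy => ?_⟩
  by_contra hnot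
  obtain ⟨i, hi, hni⟩ := hA3 (ψ x) (ψ y) (hψ x) (hψ y) ⟨ε, hnot⟩
  have hi' := (hδ i).1 hi
  rw [hψ' x i hi', hψ' y i hi'] at hni
  exact hni (hφ i δ hi' x y hxy)

end Ultrafilters

/-! ### Absoluteness of basic set-theoretic notions -/

namespace VStructure

variable {o : Ordinal.{u}}

theorem mem_def {x y : VStructure o} : x ∈ y ↔ x.val ∈ y.val := Iff.rfl

theorem val_subset (x : VStructure (o + 1)) : x.val ⊆ V_ o := by
  simpa using x.property

/-- The set `z ∈ V_o`, as an element of `⟨V_{o+1}, ∈⟩`. -/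
def ofMem (z : ZFSet.{u}) (h : z ∈ V_ o) : VStructure (o + 1) :=
  ⟨z, ZFSet.vonNeumann_subset_of_le (by simp) h⟩

/-- The class `z ⊆ V_o`, as an element of `⟨V_{o+1}, ∈⟩`. -/
def ofSubset (z : ZFSet.{u}) (h : z ⊆ V_ o) : VStructure (o + 1) :=
  ⟨z, by simpa using h⟩

@[simp] theorem val_ofMem {z : ZFSet.{u}} (h : z ∈ V_ o) : (ofMem z h).val = z := rfl

@[simp] theorem val_ofSubset {z : ZFSet.{u}} (h : z ⊆ V_ o) : (ofSubset z h).val = z := rfl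

theorem isSet_iff {x : VStructure (o + 1)} : SetModel.IsSet x ↔ x.val ∈ V_ o :=
  ⟨fun ⟨y, hy⟩ => y.val_subset hy, fun h => ⟨ofSubset (V_ o) (fun _ h => h), h⟩⟩

theorem isSet_of_mem {x y : VStructure (o + 1)} (h : x ∈ y) : x.val ∈ V_ o :=
  isSet_iff.1 ⟨y, h⟩

theorem exists_val_eq {z : ZFSet.{u}} {y : VStructure (o + 1)} (h : z ∈ y.val) :
    ∃ x : VStructure (o + 1), x.val = z :=
  ⟨ofMem z (y.val_subset h), rfl⟩

/-- Transitivity at work: members of a class lie in `V_ o`, so bounded quantifiers mean the same in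
the structure and in the universe. -/
theorem forall_mem_iff {y : VStructure (o + 1)} {p : ZFSet.{u} → Prop} :
    (∀ x : VStructure (o + 1), x ∈ y → p x.val) ↔ ∀ z ∈ y.val, p z :=
  ⟨fun h z hz => h (ofMem z (y.val_subset hz)) hz, fun h _ hx => h _ hx⟩

theorem exists_mem_iff {y : VStructure (o + 1)} {p : ZFSet.{u} → Prop} :
    (∃ x : VStructure (o + 1), x ∈ y ∧ p x.val) ↔ ∃ z ∈ y.val, p z :=
  ⟨fun ⟨_, hx⟩ => ⟨_, hx⟩, fun ⟨z, hz, hp⟩ => ⟨ofMem z (y.val_subset hz), hz, hp⟩⟩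

theorem sub_iff {x y : VStructure (o + 1)} : SetModel.Sub x y ↔ x.val ⊆ y.val :=
  forall_mem_iff (p := fun z => z ∈ y.val)

theorem isUPair_iff {z a b : VStructure (o + 1)} :
    SetModel.IsUPair z a b ↔ z.val = {a.val, b.val} := by
  constructor
  · intro h
    ext w
    rw [ZFSet.mem_pair]
    constructor
    · intro hw
      obtain ⟨w, rfl⟩ := exists_val_eq hw
      rcases (h w).1 hw with rfl | rfl <;> simp
    · rintro (rfl | rfl)
      · exact (h a).2 (.inl rfl)
      · exact (h b).2 (.inr rfl)
  · intro h w
    rw [mem_def, h, ZFSet.mem_pair, VStructure.ext_iff, VStructure.ext_iff]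

theorem isOPair_iff {p a b : VStructure (o + 1)} :
    SetModel.IsOPair p a b ↔ p.val = ZFSet.pair a.val b.val := by
  simp only [SetModel.IsOPair, isUPair_iff]
  constructor
  · rintro ⟨s, t, hs, ht, hp⟩
    rw [hp, hs, ht, ZFSet.pair, ZFSet.pair_eq_singleton]
  · intro h
    have hs : {a.val} ∈ p.val := by simp [h, ZFSet.pair]
    have ht : {a.val, b.val} ∈ p.val := by simp [h, ZFSet.pair]
    exact ⟨ofMem _ (p.val_subset hs), ofMem _ (p.val_subset ht),
      by simp [ZFSet.pair_eq_singleton], by simp, by simp [h, ZFSet.pair]⟩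

theorem pairMem_iff {a b f : VStructure (o + 1)} :
    SetModel.PairMem a b f ↔ ZFSet.pair a.val b.val ∈ f.val := by
  simp only [SetModel.PairMem, isOPair_iff]
  rw [exists_mem_iff (p := fun p => p = ZFSet.pair a.val b.val)]
  simp

theorem isRel_iff {f a b : VStructure (o + 1)} :
    SetModel.IsRel f a b ↔ f.val ⊆ ZFSet.prod a.val b.val := by
  simp only [SetModel.IsRel, isOPair_iff]
  constructor
  · intro h p hp
    obtain ⟨p, rfl⟩ := exists_val_eq hp
    obtain ⟨x, y, hx, hy, h⟩ := h p hp
    exact ZFSet.mem_prod.2 ⟨_, hx, _, hy, h⟩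
  · intro h p hp
    obtain ⟨x, hx, y, hy, h⟩ := ZFSet.mem_prod.1 (h hp)
    obtain ⟨x, rfl⟩ := exists_val_eq hx
    obtain ⟨y, rfl⟩ := exists_val_eq hy
    exact ⟨x, y, hx, hy, h⟩

theorem isFun_iff {f a b : VStructure (o + 1)} :
    SetModel.IsFun f a b ↔ ZFSet.IsFunc a.val b.val f.val := by
  rw [SetModel.IsFun, isRel_iff, ZFSet.IsFunc]
  refine and_congr_right fun hf => ?_
  simp only [pairMem_iff]
  rw [← forall_mem_iff (p := fun x => ∃! y, ZFSet.pair x y ∈ f.val)]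
  refine forall₂_congr fun x hx => ?_
  constructor
  · rintro ⟨y, hy, hu⟩
    refine ⟨y.val, hy, fun z hz => ?_⟩
    obtain ⟨z, rfl⟩ := exists_val_eq (ZFSet.pair_mem_prod.1 (hf hz)).2
    exact congrArg _ (hu z hz)
  · rintro ⟨y, hy, hu⟩
    obtain ⟨y, rfl⟩ := exists_val_eq (ZFSet.pair_mem_prod.1 (hf hy)).2
    exact ⟨y, hy, fun z hz => VStructure.ext (hu _ hz)⟩

end VStructure

/-! ### Functions as sets, and closure properties of `V_ o` -/

namespace ZFSet

/-- The graph of a function, as a set of ordered pairs. -/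
def graphOf {a b : ZFSet.{u}} (φ : a → b) : ZFSet.{u} :=
  (prod a b).sep fun p => ∃ x : a, p = pair x (φ x)

variable {a b x y : ZFSet.{u}}

theorem graphOf_subset (φ : a → b) : graphOf φ ⊆ prod a b := fun _ hp => (mem_sep.1 hp).1

theorem mem_graphOf {φ : a → b} {p : ZFSet.{u}} : p ∈ graphOf φ ↔ ∃ x : a, p = pair x (φ x) := by
  rw [graphOf, mem_sep, and_iff_right_iff_imp]
  rintro ⟨x, rfl⟩
  exact pair_mem_prod.2 ⟨x.2, (φ x).2⟩

theorem pair_mem_graphOf {φ : a → b} : pair x y ∈ graphOf φ ↔ ∃ h : x ∈ a, y = φ ⟨x, h⟩ := by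
  rw [mem_graphOf]
  constructor
  · rintro ⟨x', h⟩
    obtain ⟨rfl, rfl⟩ := pair_inj.1 h
    exact ⟨x'.2, rfl⟩
  · rintro ⟨h, rfl⟩
    exact ⟨⟨x, h⟩, rfl⟩

theorem isFunc_graphOf (φ : a → b) : IsFunc a b (graphOf φ) :=
  ⟨graphOf_subset φ, fun z hz => ⟨φ ⟨z, hz⟩, pair_mem_graphOf.2 ⟨hz, rfl⟩,
    fun _ h => (pair_mem_graphOf.1 h).2⟩⟩

theorem IsFunc.exists_eq_graphOf {f : ZFSet.{u}} (hf : IsFunc a b f) :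
    ∃ φ : a → b, f = graphOf φ := by
  choose φ hφ hu using hf.2
  have hb : ∀ z hz, φ z hz ∈ b := fun z hz => (pair_mem_prod.1 (hf.1 (hφ z hz))).2
  refine ⟨fun z => ⟨φ z z.2, hb _ _⟩, ?_⟩
  ext p
  rw [mem_graphOf]
  constructor
  · intro hp
    obtain ⟨x, hx, y, -, rfl⟩ := mem_prod.1 (hf.1 hp)
    exact ⟨⟨x, hx⟩, by simp only [hu x hx y hp]⟩
  · rintro ⟨x, rfl⟩
    exact hφ _ _

theorem nonempty_equiv_iff : Nonempty (a ≃ b) ↔ card a = card b := by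
  rw [← Cardinal.eq, cardinalMk_coe_sort, cardinalMk_coe_sort, Cardinal.lift_inj]

theorem unorderedPair_mem_vonNeumann {o : Ordinal.{u}} (ho : Order.IsSuccLimit o)
    (ha : a ∈ V_ o) (hb : b ∈ V_ o) : ({a, b} : ZFSet.{u}) ∈ V_ o := by
  rw [mem_vonNeumann] at *
  rw [rank_pair]
  exact max_lt (ho.succ_lt ha) (ho.succ_lt hb)

theorem powerset_mem_vonNeumann {o : Ordinal.{u}} (ho : Order.IsSuccLimit o)
    (ha : a ∈ V_ o) : powerset a ∈ V_ o := by
  rw [mem_vonNeumann] at *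
  rw [rank_powerset]
  exact ho.succ_lt ha

theorem sUnion_mem_vonNeumann {o : Ordinal.{u}} (ha : a ∈ V_ o) : (⋃₀ a : ZFSet.{u}) ∈ V_ o := by
  rw [mem_vonNeumann] at *
  exact (rank_sUnion_le a).trans_lt ha

theorem prod_mem_vonNeumann {o : Ordinal.{u}} (ho : Order.IsSuccLimit o)
    (ha : a ∈ V_ o) (hb : b ∈ V_ o) : prod a b ∈ V_ o :=
  mem_vonNeumann_of_subset (show pairSep _ a b ⊆ powerset (powerset (a ∪ b)) from sep_subset)
    (powerset_mem_vonNeumann ho (powerset_mem_vonNeumann ho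
      (sUnion_mem_vonNeumann (unorderedPair_mem_vonNeumann ho ha hb))))

theorem card_lt_of_mem_vonNeumann {κ : Cardinal.{u}} (hκ : κ.IsInaccessible)
    (ha : a ∈ V_ κ.ord) : card a < κ := by
  rw [mem_vonNeumann] at ha
  calc card a ≤ card (V_ (rank a)) := card_mono (subset_vonNeumann_self a)
    _ = Cardinal.preBeth (rank a) := card_vonNeumann _
    _ < Cardinal.preBeth κ.ord := Cardinal.preBeth_strictMono ha
    _ = κ := hκ.preBeth_ord

/-- By regularity, the ranks of fewer than `κ` members, each below `κ`, are bounded below `κ`.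
`Shrink` brings the index type down to `Type u`. -/
theorem mem_vonNeumann_of_card_lt {κ : Cardinal.{u}} (hκ : κ.IsInaccessible)
    (ha : a ⊆ V_ κ.ord) (hc : card a < κ) : a ∈ V_ κ.ord := by
  rw [mem_vonNeumann]
  refine lt_of_le_of_lt (b := ⨆ z : Shrink a, rank ((equivShrink a).symm z).1 + 1) ?_ ?_
  · rw [rank_le_iff]
    intro y hy
    refine (lt_add_one _).trans_le ?_
    refine (Ordinal.le_iSup _ (equivShrink a ⟨y, hy⟩)).trans' ?_
    simp
  · refine Ordinal.iSup_add_one_lt_of_lt_cof ?_ fun z => ?_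
    · rwa [hκ.isRegular.cof_ord]
    · exact mem_vonNeumann.1 (ha ((equivShrink a).symm z).2)

theorem toZFSet_mem_vonNeumann {α o : Ordinal.{u}} : α.toZFSet ∈ V_ o ↔ α < o := by
  rw [mem_vonNeumann, Ordinal.rank_toZFSet]

end ZFSet

/-! ### Ordinals and equinumerosity in the structure -/

namespace VStructure

variable {o : Ordinal.{u}}

theorem isOrd_iff {a : VStructure (o + 1)} :
    SetModel.IsOrd a ↔ ∃ α < o, a.val = α.toZFSet := by
  have h : SetModel.IsOrd a ↔ a.val ∈ V_ o ∧ a.val.IsOrdinal := by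
    rw [SetModel.IsOrd, isSet_iff, ZFSet.isOrdinal_iff_forall_mem_isTransitive]
    simp only [sub_iff]
    rw [forall_mem_iff (p := fun x => x ⊆ a.val), ← forall_mem_iff (p := ZFSet.IsTransitive)]
    refine and_congr_right fun _ => and_congr_right fun _ => forall₂_congr fun x _ => ?_
    exact forall_mem_iff (p := fun y => y ⊆ x.val)
  rw [h]
  constructor
  · rintro ⟨h1, h2⟩
    exact ⟨a.val.rank, ZFSet.mem_vonNeumann.1 h1, h2.toZFSet_rank_eq.symm⟩
  · rintro ⟨α, hα, h⟩
    rw [h]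
    exact ⟨ZFSet.toZFSet_mem_vonNeumann.2 hα, ZFSet.isOrdinal_toZFSet α⟩

/-- For limit `o`, `V_ o` is closed under products and subsets, so every true bijection between two
of its elements is a set of the model. -/
theorem equinumerous_iff (ho : Order.IsSuccLimit o) {a b : VStructure (o + 1)}
    (ha : a.val ∈ V_ o) (hb : b.val ∈ V_ o) :
    SetModel.Equinumerous a b ↔ a.val.card = b.val.card := by
  rw [← ZFSet.nonempty_equiv_iff]
  constructor
  · rintro ⟨f, -, hf, hf'⟩
    obtain ⟨φ, hφ⟩ := (isFun_iff.1 hf).exists_eq_graphOf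
    simp only [pairMem_iff, hφ, ZFSet.pair_mem_graphOf] at hf'
    refine ⟨Equiv.ofBijective φ ⟨fun x y hxy => ?_, fun y => ?_⟩⟩
    · obtain ⟨x', hx'⟩ := exists_val_eq x.2
      obtain ⟨y', hy'⟩ := exists_val_eq y.2
      obtain ⟨z, hz⟩ := exists_val_eq (φ x).2
      have hzb : z ∈ b := by rw [mem_def, hz]; exact (φ x).2
      have := (hf' z hzb).unique (y₁ := x') (y₂ := y')
        ⟨hx'.symm ▸ x.2, by simp [hz, hx']⟩ ⟨hy'.symm ▸ y.2, by simp [hz, hxy, hy']⟩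
      exact Subtype.ext (by rw [← hx', ← hy', this])
    · obtain ⟨y', hy'⟩ := exists_val_eq y.2
      obtain ⟨x, ⟨hx, hxy⟩, -⟩ := hf' y' (hy'.symm ▸ y.2 : y'.val ∈ b.val)
      exact ⟨⟨x.val, hx⟩, Subtype.ext (by rw [← hxy, hy'])⟩
  · rintro ⟨φ⟩
    have hmem := ZFSet.mem_vonNeumann_of_subset (ZFSet.graphOf_subset φ)
      (ZFSet.prod_mem_vonNeumann ho ha hb)
    refine ⟨ofMem _ hmem, isSet_iff.2 hmem, isFun_iff.2 (ZFSet.isFunc_graphOf φ), fun y hy => ?_⟩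
    simp only [pairMem_iff, val_ofMem, ZFSet.pair_mem_graphOf]
    have hx := (φ.symm ⟨y.val, hy⟩).2
    refine ⟨ofMem _ (a.val_subset hx), ⟨hx, by simp⟩, ?_⟩
    rintro x ⟨hxa, hxy⟩
    apply VStructure.ext
    have : (⟨y.val, hy⟩ : b.val) = φ ⟨x.val, hxa⟩ := Subtype.ext hxy
    simp [this]

end VStructure

/-! ### No strongly compact cardinal in the structure -/

namespace VStructure

open Filter

variable {κ μ : Cardinal.{u}} {o : Ordinal.{u}}

theorem exists_eq_toZFSet_ord_of_isUncountableCard (ho : Order.IsSuccLimit o) {k : VStructure (o + 1)} :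
    SetModel.IsUncountableCard k →
      ∃ μ : Cardinal.{u}, ℵ₀ < μ ∧ μ.ord < o ∧ k.val = μ.ord.toZFSet := by
  rintro ⟨⟨hk, hcard⟩, w, ⟨⟨hw, ⟨n, hn⟩, hlim⟩, -⟩, hwk⟩
  obtain ⟨α, hα, hkα⟩ := isOrd_iff.1 hk
  obtain ⟨β, hβ, hwβ⟩ := isOrd_iff.1 hw
  -- Otherwise the initial ordinal of `α.card` is a smaller ordinal equinumerous with `k`.
  have hα' : α = α.card.ord := by
    by_contra hne
    have hlt := (Cardinal.ord_card_le α).lt_of_ne' hne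
    have hmem : α.card.ord.toZFSet ∈ k.val := by
      rw [hkα]; exact Ordinal.toZFSet_mem_toZFSet_iff.2 hlt
    obtain ⟨a, ha⟩ := exists_val_eq hmem
    refine hcard a (by rwa [mem_def, ha]) ((equinumerous_iff ho ?_ (isSet_iff.1 hk.1)).2 ?_)
    · exact k.val_subset (ha ▸ hmem)
    · rw [ha, hkα, Ordinal.card_toZFSet, Ordinal.card_toZFSet, Cardinal.card_ord]
  refine ⟨α.card, ?_, hα' ▸ hα, hα' ▸ hkα⟩
  have hβα : β < α := by
    rw [mem_def, hwβ, hkα] at hwk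
    exact Ordinal.toZFSet_mem_toZFSet_iff.1 hwk
  have hβlim : Order.IsSuccLimit β := by
    rw [Ordinal.isSuccLimit_iff, Order.isSuccPrelimit_iff_succ_lt]
    constructor
    · rintro rfl
      rw [mem_def, hwβ] at hn
      simp at hn
    · intro γ hγ
      have hmem : γ.toZFSet ∈ w.val := by
        rw [hwβ]; exact Ordinal.toZFSet_mem_toZFSet_iff.2 hγ
      obtain ⟨x, hx⟩ := exists_val_eq hmem
      obtain ⟨y, hy, hxy⟩ := hlim x (by rwa [mem_def, hx])
      rw [mem_def, hwβ, Ordinal.mem_toZFSet_iff] at hy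
      obtain ⟨δ, hδ, hyδ⟩ := hy
      rw [mem_def, hx, ← hyδ, Ordinal.toZFSet_mem_toZFSet_iff] at hxy
      exact (Order.succ_le_of_lt hxy).trans_lt hδ
  have h1 := (Ordinal.omega0_le_of_isSuccLimit hβlim).trans_lt hβα
  rw [hα', Cardinal.lt_ord, Ordinal.card_omega0] at h1
  exact h1

theorem cardLT_iff (ho : Order.IsSuccLimit o) {x k : VStructure (o + 1)} (hx : x.val ∈ V_ o)
    (hk : k.val = μ.ord.toZFSet) : SetModel.CardLT x k ↔ x.val.card < μ := by
  constructor
  · rintro ⟨a, ha, hxa⟩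
    rw [equinumerous_iff ho hx (isSet_of_mem ha)] at hxa
    rw [mem_def, hk, Ordinal.mem_toZFSet_iff] at ha
    obtain ⟨β, hβ, hβa⟩ := ha
    rwa [hxa, ← hβa, Ordinal.card_toZFSet, ← Cardinal.lt_ord]
  · intro h
    have hmem : x.val.card.ord.toZFSet ∈ k.val := by
      rw [hk, Ordinal.toZFSet_mem_toZFSet_iff]
      exact Cardinal.ord_strictMono h
    obtain ⟨a, ha⟩ := exists_val_eq hmem
    refine ⟨a, by rwa [mem_def, ha], (equinumerous_iff ho hx (k.val_subset (ha ▸ hmem))).2 ?_⟩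
    rw [ha, Ordinal.card_toZFSet, Cardinal.card_ord]

theorem isCompactFor_of_isStronglyCompactIn (hκ : ℵ₀ ≤ κ) (hμ : ℵ₀ < μ)
    {k : VStructure (κ.ord + 1)} (hk : k.val = μ.ord.toZFSet)
    (h : SetModel.IsStronglyCompactIn k) (A : Type u) (hA : #A < κ) : IsCompactFor μ A := by
  have ho := Cardinal.isSuccLimit_ord hκ
  have hζ : (#A).ord.toZFSet ∈ V_ κ.ord :=
    ZFSet.toZFSet_mem_vonNeumann.2 (Cardinal.ord_strictMono hA)
  obtain ⟨e⟩ : Nonempty (A ≃ (#A).ord.toZFSet) := by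
    rw [← Cardinal.lift_mk_eq', ZFSet.cardinalMk_coe_sort, Ordinal.card_toZFSet, Cardinal.card_ord,
      Cardinal.lift_lift]
  -- The model's compactness is applied to an ordinal coding `A`; the resulting ultrafilter is then
  -- pushed forward to `SmallSubsets μ A`.
  obtain ⟨P, U, ⟨hPset, hP⟩, hU, hfine⟩ := h.2 (ofMem _ hζ) (isSet_iff.2 hζ)
  have hPV := isSet_iff.1 hPset
  have hUV := isSet_iff.1 hU.isSet
  -- the subset of `A` coded by an element of `P`
  let c (a : ZFSet.{u}) : Set A := {x | (e x).1 ∈ a}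
  have hc : ∀ a ∈ P.val, #(c a) < μ := by
    intro a ha
    obtain ⟨a, rfl⟩ := exists_val_eq ha
    obtain ⟨ha1, -, ha2⟩ := (hP a).1 ha
    rw [cardLT_iff ho (isSet_iff.1 ha1) hk] at ha2
    refine lt_of_le_of_lt ?_ ha2
    rw [← Cardinal.lift_le.{u + 1}, ← ZFSet.cardinalMk_coe_sort]
    refine (Cardinal.lift_mk_le'.2 ⟨⟨fun x : c a.val => (⟨(e x.1).1, x.2⟩ : a.val), ?_⟩⟩).trans
      (Cardinal.lift_id'.{u, u + 1} _).le
    intro x y hxy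
    exact Subtype.ext (e.injective (Subtype.ext (congrArg (fun z : a.val => z.1) hxy)))
  classical
  -- The empty set is a junk value; on `P` the first case always applies.
  let d (a : ZFSet.{u}) : SmallSubsets μ A :=
    if h : #(c a) < μ then ⟨c a, h⟩ else ⟨∅, by simpa using hμ.bot_lt⟩
  have hd : ∀ a ∈ P.val, (d a).1 = c a := fun a ha => by simp [d, hc a ha]
  have hsep : ∀ S : Set (SmallSubsets μ A), (P.val.sep fun a => d a ∈ S) ∈ V_ κ.ord :=
    fun S => ZFSet.mem_vonNeumann_of_subset ZFSet.sep_subset hPV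
  have hmem : ∀ S z, z ∈ (ofMem _ (hsep S)).val ↔ z ∈ P.val ∧ d z ∈ S := fun S z => by
    rw [val_ofMem, ZFSet.mem_sep]
  have heq : ∀ (T : VStructure (κ.ord + 1)) (p : ZFSet.{u} → Prop),
      (∀ a : VStructure (κ.ord + 1), a ∈ T ↔ a ∈ P ∧ p a.val) → T.val = P.val.sep p := by
    intro T p hT
    ext z
    rw [ZFSet.mem_sep]
    constructor
    · intro hz
      obtain ⟨z, rfl⟩ := exists_val_eq hz
      exact (hT z).1 hz
    · intro hz
      obtain ⟨z, rfl⟩ := exists_val_eq hz.1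
      exact (hT z).2 hz
  -- The image of `U` under the decoding map `d`.
  let l : Set (Set (SmallSubsets μ A)) := {S | (P.val.sep fun a => d a ∈ S) ∈ U.val}
  have hl : ∀ S : Set (Set (SmallSubsets μ A)), #S < μ → S ⊆ l → ⋂₀ S ∈ l := by
    intro S hS hSl
    -- The preimages of the members of `S`, as a subset of `U`. It is a set of the model because `U`
    -- is, so the model's completeness applies to it.
    let B := ZFSet.range fun s : S => P.val.sep fun a => d a ∈ s.1
    have hBU : B ⊆ U.val := by
      intro z hz
      obtain ⟨s, rfl⟩ := ZFSet.mem_range.1 hz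
      exact hSl s.2
    have hBV : B ∈ V_ κ.ord := ZFSet.mem_vonNeumann_of_subset hBU hUV
    have hBc : B.card < μ := by
      refine lt_of_le_of_lt ?_ hS
      simpa using ZFSet.lift_card_range_le (f := fun s : S => P.val.sep fun a => d a ∈ s.1)
    obtain ⟨T, hTU, hT⟩ := hU.complete (ofMem B hBV) (isSet_iff.2 hBV) (sub_iff.2 hBU)
      ((cardLT_iff ho hBV hk).2 hBc)
    have hT' := heq T (fun a => d a ∈ ⋂₀ S) fun a => by
      rw [hT]
      refine and_congr_right fun ha => ?_
      constructor
      · intro h s hs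
        have hsB : (P.val.sep fun a => d a ∈ s) ∈ B := ZFSet.mem_range.2 ⟨⟨s, hs⟩, rfl⟩
        exact ((hmem s a.val).1 (h (ofMem _ (hsep s)) hsB)).2
      · intro h s hs
        obtain ⟨t, ht⟩ := ZFSet.mem_range.1 (show s.val ∈ B from hs)
        rw [mem_def, ← ht]
        exact ZFSet.mem_sep.2 ⟨ha, h _ t.2⟩
    change (P.val.sep fun a => d a ∈ ⋂₀ S) ∈ U.val
    rw [← hT']
    exact hTU
  have hmono : ∀ s t : Set (SmallSubsets μ A), s ∈ l → s ⊆ t → t ∈ l := fun s t hs hst =>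
    hU.upward (ofMem _ (hsep s)) (ofMem _ (hsep t)) hs
      (sub_iff.2 fun z hz => (hmem t z).2 (((hmem s z).1 hz).imp_right (@hst _)))
      (sub_iff.2 fun z hz => ((hmem t z).1 hz).1)
  have h2 : 2 < μ := Cardinal.ofNat_lt_aleph0.trans hμ
  let F := Filter.ofCardinalInter l h2 hl hmono
  have hempty : ∅ ∉ l := fun h => by
    obtain ⟨a, ha⟩ := hU.proper (ofMem _ (hsep ∅)) h
    exact ((hmem ∅ a.val).1 ha).2
  let W := Ultrafilter.ofComplNotMemIff F (by
    intro s
    constructor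
    · intro hs
      rcases hU.ultra (ofMem _ (hsep s)) (isSet_iff.2 (hsep s)) (sub_iff.2 fun z hz => ((hmem s z).1 hz).1)
        with h | ⟨T, hTU, hT⟩
      · exact h
      · refine (hs ?_).elim
        have hT' := heq T (fun a => d a ∈ sᶜ) fun a => by
          rw [hT]
          refine and_congr_right fun ha => not_congr ?_
          rw [mem_def, hmem]
          exact and_iff_right ha
        change (P.val.sep fun a => d a ∈ sᶜ) ∈ U.val
        rw [← hT']
        exact hTU
    · intro hs hs'
      have := F.inter_sets hs hs'
      rw [Set.inter_compl_self] at this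
      exact hempty this)
  refine ⟨W, ⟨hl⟩, fun x => ?_⟩
  obtain ⟨T, hTU, hT⟩ := hfine (ofMem (e x).1 (ZFSet.isTransitive_vonNeumann _ _ hζ (e x).2)) (e x).2
  have hT' := heq T (fun a => d a ∈ {B : SmallSubsets μ A | x ∈ B.1}) fun a => by
    rw [hT]
    refine and_congr_right fun ha => ?_
    change _ ↔ x ∈ (d a.val).1
    rw [hd _ ha]
    rfl
  change (P.val.sep fun a => d a ∈ {B : SmallSubsets μ A | x ∈ B.1}) ∈ U.val
  rw [← hT']
  exact hTU

theorem not_satisfiesExistsStronglyCompact (hκ : IsLeast {μ : Cardinal.{u} | IsStronglyCompact μ} κ) :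
    ¬ SetModel.SatisfiesExistsStronglyCompact (VStructure (κ.ord + 1)) := by
  rintro ⟨k, hk⟩
  have hκ0 : ℵ₀ ≤ κ := hκ.1.1.le
  obtain ⟨μ, hμ, hμκ, hkμ⟩ := exists_eq_toZFSet_ord_of_isUncountableCard (Cardinal.isSuccLimit_ord hκ0) hk.1
  have hlt : μ < κ := Cardinal.ord_lt_ord.1 hμκ
  exact (hκ.2 ⟨hμ, hκ.1.isCompactFor hlt.le
    (isCompactFor_of_isStronglyCompactIn hκ0 hμ hkμ hk)⟩).not_gt hlt

end VStructure

/-! ### SWVP in the structure -/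

namespace VStructure

variable {κ : Cardinal.{u}} {o : Ordinal.{u}}

theorem isGraphWith_iff {g v e : VStructure (o + 1)} :
    SetModel.IsGraphWith g v e ↔
      g.val = ZFSet.pair v.val e.val ∧ e.val ⊆ ZFSet.prod v.val v.val := by
  rw [SetModel.IsGraphWith, isOPair_iff, isRel_iff]

theorem mem_of_pair_mem {a b : ZFSet.{u}} (h : ZFSet.pair a b ∈ V_ o) :
    a ∈ V_ o ∧ b ∈ V_ o := by
  have h1 : {a, b} ∈ V_ o :=
    ZFSet.isTransitive_vonNeumann _ _ h (by simp [ZFSet.pair])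
  exact ⟨ZFSet.isTransitive_vonNeumann _ _ h1 (by simp),
    ZFSet.isTransitive_vonNeumann _ _ h1 (by simp)⟩

theorem homExists_iff (ho : Order.IsSuccLimit o) {g g' v e v' e' : VStructure (o + 1)}
    (hg : SetModel.IsGraphWith g v e) (hg' : SetModel.IsGraphWith g' v' e')
    (hv : v.val ∈ V_ o) (hv' : v'.val ∈ V_ o) :
    SetModel.HomExists g g' ↔ ∃ φ : v.val → v'.val, ∀ x y : v.val,
      ZFSet.pair x.1 y.1 ∈ e.val → ZFSet.pair (φ x).1 (φ y).1 ∈ e'.val := by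
  constructor
  · rintro ⟨h, -, w, f, w', f', hw, hw', hfun, hhom⟩
    obtain ⟨h1, h2⟩ := ZFSet.pair_inj.1 ((isGraphWith_iff.1 hg).1.symm.trans (isGraphWith_iff.1 hw).1)
    obtain ⟨h3, h4⟩ :=
      ZFSet.pair_inj.1 ((isGraphWith_iff.1 hg').1.symm.trans (isGraphWith_iff.1 hw').1)
    obtain rfl := VStructure.ext h1
    obtain rfl := VStructure.ext h2
    obtain rfl := VStructure.ext h3
    obtain rfl := VStructure.ext h4
    obtain ⟨φ, hφ⟩ := (isFun_iff.1 hfun).exists_eq_graphOf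
    refine ⟨φ, fun x y hxy => ?_⟩
    have hm : ∀ {z : ZFSet.{u}} {w : VStructure (o + 1)}, z ∈ w.val → z ∈ V_ o :=
      fun {_ w} hz => w.val_subset hz
    have := hhom (ofMem x.1 (hm x.2)) (ofMem y.1 (hm y.2)) (ofMem (φ x).1 (hm (φ x).2))
      (ofMem (φ y).1 (hm (φ y).2))
    simp only [pairMem_iff, val_ofMem, hφ, ZFSet.pair_mem_graphOf] at this
    exact this hxy ⟨x.2, trivial⟩ ⟨y.2, trivial⟩
  · rintro ⟨φ, hφ⟩
    have hmem := ZFSet.mem_vonNeumann_of_subset (ZFSet.graphOf_subset φ)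
      (ZFSet.prod_mem_vonNeumann ho hv hv')
    refine ⟨ofMem _ hmem, isSet_iff.2 hmem, v, e, v', e', hg, hg',
      isFun_iff.2 (ZFSet.isFunc_graphOf φ), ?_⟩
    simp only [pairMem_iff, val_ofMem, ZFSet.pair_mem_graphOf]
    rintro x y x' y' hxy ⟨hx, hx'⟩ ⟨hy, hy'⟩
    rw [hx', hy']
    exact hφ _ _ hxy

theorem satisfiesSWVP (hκ : IsSupercompact κ) (hin : κ.IsInaccessible) :
    SetModel.SatisfiesSWVP (VStructure (κ.ord + 1)) := by
  rintro ⟨F, ⟨hF1, hF2⟩, hdown, hup⟩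
  have ho := Cardinal.isSuccLimit_ord hκ.1.le
  let α (i : κ.ord.ToType) : VStructure (κ.ord + 1) :=
    ofMem (Ordinal.ToType.toOrd i).1.toZFSet
      (ZFSet.toZFSet_mem_vonNeumann.2 (Ordinal.ToType.toOrd i).2)
  have hα : ∀ i, SetModel.IsOrd (α i) := fun i => isOrd_iff.2 ⟨_, (Ordinal.ToType.toOrd i).2, rfl⟩
  have hαlt : ∀ i j, i < j → α i ∈ α j := fun i j hij =>
    Ordinal.toZFSet_mem_toZFSet_iff.2 (Ordinal.ToType.mk.symm.lt_iff_lt.2 hij)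
  choose g hg using fun i => (hF2 (α i) (hα i)).exists
  have hgraph : ∀ i, SetModel.IsGraph (g i) := by
    intro i
    obtain ⟨p, hp, hpi⟩ := hg i
    obtain ⟨β, g', -, hg', hpg⟩ := hF1 p hp
    have h := (ZFSet.pair_inj.1 ((isOPair_iff.1 hpi).symm.trans (isOPair_iff.1 hpg))).2
    rwa [VStructure.ext h]
  choose v e hve using hgraph
  have hv : ∀ i, (v i).val ∈ V_ κ.ord := by
    intro i
    have h1 := F.val_subset (pairMem_iff.1 (hg i))
    have h2 := (mem_of_pair_mem h1).2
    rw [(isGraphWith_iff.1 (hve i)).1] at h2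
    exact (mem_of_pair_mem h2).1
  -- The vertex sets, as types, live in `Type (u + 1)`; `Shrink` gives copies in `Type u`, where
  -- supercompactness speaks.
  have key := hκ.exists_hom (V := fun i => Shrink (v i).val)
    (fun i => ZFSet.card_lt_of_mem_vonNeumann hin (hv i))
    (fun i x y => ZFSet.pair ((equivShrink _).symm x).1 ((equivShrink _).symm y).1 ∈ (e i).val)
  obtain ⟨i, j, hij, φ, hφ⟩ := key (by
    intro i j hij
    obtain ⟨φ, hφ⟩ := (homExists_iff ho (hve j) (hve i) (hv j) (hv i)).1
      (hdown _ _ _ _ (hα i) (hα j) (hg i) (hg j) (.inl (hαlt i j hij)))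
    exact ⟨fun x => equivShrink _ (φ ((equivShrink _).symm x)), fun x y hxy => by
      simpa using hφ _ _ hxy⟩)
  refine hup _ _ _ _ (hα i) (hα j) (hg i) (hg j) (hαlt i j hij)
    ((homExists_iff ho (hve i) (hve j) (hv i) (hv j)).2
      ⟨fun x => (equivShrink _).symm (φ (equivShrink _ x)), fun x y hxy => hφ _ _ (by simpa using hxy)⟩)

end VStructure

/-! ### GB + AC in the structure -/

namespace VStructure

variable {κ : Cardinal.{u}} {o : Ordinal.{u}}

theorem satisfiesGBAC (hκ : κ.IsInaccessible) :
    SetModel.SatisfiesGBAC (VStructure (κ.ord + 1)) := by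
  have ho := Cardinal.isSuccLimit_ord hκ.aleph0_lt.le
  constructor
  case extensionality =>
    intro X Y h
    apply VStructure.ext
    ext z
    constructor
    · intro hz
      obtain ⟨z, rfl⟩ := exists_val_eq hz
      exact (h z).1 hz
    · intro hz
      obtain ⟨z, rfl⟩ := exists_val_eq hz
      exact (h z).2 hz
  case comprehension =>
    intro φ a
    -- All subsets of `V_κ` are classes, so comprehension holds for any predicate whatsoever.
    refine ⟨ofSubset ((V_ κ.ord).sep fun z => ∃ x : VStructure (κ.ord + 1), x.val = z ∧
      φ.Holds (Function.update a 0 x)) ZFSet.sep_subset, fun x => ?_⟩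
    rw [mem_def, val_ofSubset, ZFSet.mem_sep, isSet_iff]
    refine and_congr_right fun _ => ⟨?_, fun h => ⟨x, rfl, h⟩⟩
    rintro ⟨y, hy, h⟩
    rwa [← VStructure.ext hy]
  case foundation =>
    rintro X ⟨x, hx⟩
    obtain ⟨y, hy, h⟩ := ZFSet.regularity X.val
      (fun h => ZFSet.notMem_empty x.val (h ▸ hx))
    obtain ⟨y, rfl⟩ := exists_val_eq hy
    refine ⟨y, hy, fun z hzy hzX => ZFSet.notMem_empty z.val ?_⟩
    rw [← h]
    exact ZFSet.mem_inter.2 ⟨hzX, hzy⟩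
  case pairing =>
    intro a b ha hb
    have h := ZFSet.unorderedPair_mem_vonNeumann ho (isSet_iff.1 ha) (isSet_iff.1 hb)
    exact ⟨ofMem _ h, isSet_iff.2 h, isUPair_iff.2 rfl⟩
  case union =>
    intro a ha
    have h := ZFSet.sUnion_mem_vonNeumann (isSet_iff.1 ha)
    refine ⟨ofMem _ h, isSet_iff.2 h, fun x => ?_⟩
    rw [mem_def, val_ofMem, ZFSet.mem_sUnion]
    exact (exists_mem_iff (p := fun z => x.val ∈ z)).symm
  case powerset =>
    intro a ha
    have h := ZFSet.powerset_mem_vonNeumann ho (isSet_iff.1 ha)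
    refine ⟨ofMem _ h, isSet_iff.2 h, fun x => ?_⟩
    rw [mem_def, val_ofMem, ZFSet.mem_powerset, sub_iff, isSet_iff]
    exact ⟨fun hx => ⟨ZFSet.mem_vonNeumann_of_subset hx (isSet_iff.1 ha), hx⟩, And.right⟩
  case infinity =>
    have hω : Ordinal.omega0.toZFSet ∈ V_ κ.ord := by
      rw [ZFSet.toZFSet_mem_vonNeumann, Cardinal.lt_ord, Ordinal.card_omega0]
      exact hκ.aleph0_lt
    refine ⟨ofMem _ hω, isSet_iff.2 hω, ?_, ?_⟩
    · have h0 : (∅ : ZFSet.{u}) ∈ Ordinal.omega0.toZFSet :=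
        Ordinal.mem_toZFSet_iff.2 ⟨0, Ordinal.omega0_pos, by simp⟩
      exact ⟨ofMem ∅ (ZFSet.isTransitive_vonNeumann _ _ hω h0), h0, fun z hz =>
        ZFSet.notMem_empty _ hz⟩
    · intro x hx
      obtain ⟨n, hn, hnx⟩ := Ordinal.mem_toZFSet_iff.1 hx
      have h1 : (n + 1).toZFSet ∈ Ordinal.omega0.toZFSet :=
        Ordinal.toZFSet_mem_toZFSet_iff.2 (Ordinal.isSuccLimit_omega0.add_one_lt hn)
      refine ⟨ofMem _ (ZFSet.isTransitive_vonNeumann _ _ hω h1), h1, fun z => ?_⟩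
      rw [mem_def, val_ofMem, Ordinal.toZFSet_add_one, ZFSet.mem_insert_iff, hnx,
        VStructure.ext_iff, or_comm]
      rfl
  case replacement =>
    intro F a ha hF
    let b := (V_ κ.ord).sep fun y => ∃ x ∈ a.val, ZFSet.pair x y ∈ F.val
    have hb : ∀ y : b, ∃ x : a.val, ZFSet.pair x.1 y.1 ∈ F.val := fun y => by
      obtain ⟨x, hx, hxy⟩ := (ZFSet.mem_sep.1 y.2).2
      exact ⟨⟨x, hx⟩, hxy⟩
    choose f hf using hb
    -- A chosen preimage determines its value because `F` is single-valued. Thus the image has size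
    -- less than `κ`, and by inaccessibility it is an element of `V_κ`.
    have hinj : Function.Injective f := by
      intro y y' hyy
      obtain ⟨x, hx⟩ := exists_val_eq (f y).2
      obtain ⟨w, hw⟩ := exists_val_eq (y := ofSubset b ZFSet.sep_subset) y.2
      obtain ⟨w', hw'⟩ := exists_val_eq (y := ofSubset b ZFSet.sep_subset) y'.2
      have := hF x w w' (pairMem_iff.2 (by rw [hx, hw]; exact hf y))
        (pairMem_iff.2 (by rw [hx, hw', hyy]; exact hf y'))
      exact Subtype.ext (by rw [← hw, ← hw', this])
    have hcard : b.card ≤ a.val.card := by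
      rw [← Cardinal.lift_le.{u + 1}, ← ZFSet.cardinalMk_coe_sort, ← ZFSet.cardinalMk_coe_sort]
      exact Cardinal.mk_le_of_injective hinj
    have hbV : b ∈ V_ κ.ord := ZFSet.mem_vonNeumann_of_card_lt hκ ZFSet.sep_subset
      (hcard.trans_lt (ZFSet.card_lt_of_mem_vonNeumann hκ (isSet_iff.1 ha)))
    refine ⟨ofMem b hbV, isSet_iff.2 hbV, fun y => ?_⟩
    simp only [pairMem_iff]
    rw [exists_mem_iff (p := fun x => ZFSet.pair x y.val ∈ F.val), mem_def, val_ofMem,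
      ZFSet.mem_sep, and_iff_right_iff_imp]
    rintro ⟨x, -, hx⟩
    exact (mem_of_pair_mem (F.val_subset hx)).2
  case choice =>
    intro a ha hne
    have h1 : ∀ x : a.val, ∃ y, y ∈ x.1 := fun x =>
      (forall_mem_iff (y := a) (p := fun z => ∃ y, y ∈ z)).1
        (fun x hx => (hne x hx).elim fun y hy => ⟨y.val, hy⟩) x.1 x.2
    choose f hf using h1
    let φ (x : a.val) : (⋃₀ a.val : ZFSet.{u}) := ⟨f x, ZFSet.mem_sUnion.2 ⟨x.1, x.2, hf x⟩⟩
    have hφ := ZFSet.mem_vonNeumann_of_subset (ZFSet.graphOf_subset φ)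
      (ZFSet.prod_mem_vonNeumann ho (isSet_iff.1 ha)
        (ZFSet.sUnion_mem_vonNeumann (isSet_iff.1 ha)))
    refine ⟨ofMem _ hφ, isSet_iff.2 hφ, ?_, ?_⟩
    · intro p hp
      obtain ⟨x, hx⟩ := ZFSet.mem_graphOf.1 (show p.val ∈ ZFSet.graphOf φ from hp)
      have hxV := a.val_subset x.2
      exact ⟨ofMem x.1 hxV, ofMem (f x) (ZFSet.isTransitive_vonNeumann _ _ hxV (hf x)), x.2, hf x,
        isOPair_iff.2 hx⟩
    · have hfun : SetModel.IsFun (ofMem _ hφ) a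
          (ofMem _ (ZFSet.sUnion_mem_vonNeumann (isSet_iff.1 ha))) :=
        isFun_iff.2 (ZFSet.isFunc_graphOf φ)
      exact hfun.2

end VStructure

theorem mainTheorem4 (κ : Cardinal.{u})
    (hsuper : IsLeast {μ : Cardinal.{u} | IsSupercompact μ} κ)
    (hstrong : IsLeast {μ : Cardinal.{u} | IsStronglyCompact μ} κ) :
    (SetModel.SatisfiesSWVP (VStructure (κ.ord + 1)) ∧
      ¬ SetModel.SatisfiesExistsStronglyCompact (VStructure (κ.ord + 1))) ∧
    SetModel.SatisfiesGBAC (VStructure (κ.ord + 1)) ∧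
    ¬ (∀ (M : Type (u + 1)) [Membership M M],
        SetModel.SatisfiesGBAC M → SetModel.SatisfiesSWVP M →
          SetModel.SatisfiesExistsStronglyCompact M) := by
  have hin := hstrong.1.isInaccessible
  have h1 := VStructure.satisfiesSWVP hsuper.1 hin
  have h2 := VStructure.not_satisfiesExistsStronglyCompact hstrong
  have h3 := VStructure.satisfiesGBAC hin
  exact ⟨⟨h1, h2⟩, h3, fun h => h2 (h _ h3 h1)⟩
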